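/- **Theorem (Necessary optimality condition).** Let $n,m$ be natural numbers, let $S\subseteq\mathbb{R}^n$ be a nonempty closed set, and let $\beta\in\mathbb{R}$. For $i=1,\dots,m$ let $f_i,g_i:\mathbb{R}^n\to(-\infty,+\infty]$ and $h_i:\mathbb{R}^n\to\mathbb{R}$ be functions such that, each on some open set containing $S$, $f_i$ is finite and locally Lipschitz, $g_i$ is finite and continuously differentiable, and $h_i$ is $\beta$-weakly convex; here $h$ is called $\beta$-weakly convex on an open set $U$ if $x\mapsto h(x)+\frac{\beta}{2}\|x\|^2$ is convex on every convex subset of $U$ (if $U$ is convex, this is convexity on $U$). Put $F_i=f_i+g_i-h_i$ and $F=(F_1,\dots,F_m)$, and consider the problem $\min_{x\in S}F(x)$. Let $\bar x\in S$ be a local weak Pareto solution, that is, there is a neighborhood $U$ of $\bar x$ such that no $x\in S\cap U$ satisfies $F(x)\in F(\bar x)-\operatorname{int}\mathbb{R}^m_+$. Then $\bar x$ is a stationary point: there is $\lambda=(\lambda_1,\dots,\lambda_m)\in\mathbb{R}^m_+\setminus\{0\}$ such that $$0\in\sum_{i=1}^m\lambda_i\bigl(\partial f_i(\bar x)+\nabla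 g_i(\bar x)-\partial h_i(\bar x)\bigr)+N_S(\bar x),$$ where sums, differences and multiples of sets are taken in the sense of Minkowski. Here, for a subset $D$ of a Euclidean space and $x\in D$, the regular normal cone is $$\widehat N_D(x)=\Bigl\{v : \limsup_{y\to x,\ y\in D}\frac{\langle v,y-x\rangle}{\|y-x\|}\le 0\Bigr\},$$ the limiting normal cone $N_D(x)$ is the set of all limits $v=\lim_k v_k$ with $v_k\in\widehat N_D(x_k)$, $x_k\in D$, $x_k\to x$, and for $\varphi:\mathbb{R}^n\to(-\infty,+\infty]$ finite at $x$ the limiting (Mordukhovich) subdifferential is $$\partial\varphi(x)=\{v\in\mathbb{R}^n : (v,-1)\in N_{\operatorname{epi}\varphi}(x,\varphi(x))\},\qquad \operatorname{epi}\varphi=\{(y,\alpha)\in\mathbb{R}^n\times\mathbb{R} : \alpha\ge\varphi(y)\}.$$ -/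

import Mathlib

open Filter Topology
open scoped Pointwise

noncomputable section

namespace MOP

section NormalCones

variable {X : Type*} [NormedAddCommGroup X] [InnerProductSpace ℝ X]

/-- The regular (Fréchet) normal cone to `S` at `x`; it is empty if `x ∉ S`.
The inequality says that the upper limit of `⟪v, y - x⟫ / ‖y - x‖`,
as `y → x` with `y ∈ S`, is at most `0`. -/
def regularNormalCone (S : Set X) (x : X) : Set X :=
  {v | x ∈ S ∧ ∀ ε : ℝ, 0 < ε → ∀ᶠ y in 𝓝[S] x, inner ℝ v (y - x) ≤ ε * ‖y - x‖}

/-- The limiting (Mordukhovich) normal cone to `S` at `x`: the Painlevé–Kuratowski outer limit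
of the regular normal cones at points of `S` tending to `x`; it is empty if `x ∉ S`. -/
def limitingNormalCone (S : Set X) (x : X) : Set X :=
  {v | x ∈ S ∧ ∃ (y : ℕ → X) (w : ℕ → X),
    (∀ k, y k ∈ S) ∧ Tendsto y atTop (𝓝 x) ∧ Tendsto w atTop (𝓝 v) ∧
      ∀ k, w k ∈ regularNormalCone S (y k)}

/-- The epigraph of `φ`, in the product `X × ℝ` with its Hilbert space structure. -/
def epigraph (φ : X → EReal) : Set (WithLp 2 (X × ℝ)) :=
  {p | φ p.fst ≤ (p.snd : EReal)}

/-- The limiting (Mordukhovich) subdifferential of `φ` at `x`: the vectors `v` such that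
`(v, -1)` is a limiting normal to the epigraph at `(x, φ x)`; it is empty if `φ x` is
not finite. -/
def limitingSubdifferential (φ : X → EReal) (x : X) : Set X :=
  {v | ∃ r : ℝ, φ x = (r : EReal) ∧
    WithLp.toLp 2 (v, (-1 : ℝ)) ∈ limitingNormalCone (epigraph φ) (WithLp.toLp 2 (x, r))}

/-- `φ` takes finite values on `U` and is locally Lipschitz there. -/
def LocallyLipschitzOnSet (φ : X → EReal) (U : Set X) : Prop :=
  (∀ x ∈ U, φ x ≠ ⊤ ∧ φ x ≠ ⊥) ∧ LocallyLipschitzOn U (fun x => (φ x).toReal)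

/-- `φ` takes finite values on `U` and is continuously differentiable there (`U` open). -/
def ContDiffOnSet (φ : X → EReal) (U : Set X) : Prop :=
  (∀ x ∈ U, φ x ≠ ⊤ ∧ φ x ≠ ⊥) ∧ ContDiffOn ℝ 1 (fun x => (φ x).toReal) U

/-- `h` is `β`-weakly convex on `U`: the function `h + (β / 2) ‖·‖ ^ 2` is convex on `U`. As `U`
need not be convex, this means convexity on every convex subset of `U` (for convex `U`
it is convexity on `U` itself). -/
def WeaklyConvexOn (β : ℝ) (h : X → ℝ) (U : Set X) : Prop :=
  ∀ C : Set X, C ⊆ U → Convex ℝ C → ConvexOn ℝ C (fun x => h x + β / 2 * ‖x‖ ^ 2)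

end NormalCones

section Problem

variable {n m : ℕ}

/-- The vector objective with components `F i = f i + g i - h i`. Its values are used on the
feasible set only, where `f i` and `g i` are finite. -/
def objective (f g : Fin m → EuclideanSpace ℝ (Fin n) → EReal)
    (h : Fin m → EuclideanSpace ℝ (Fin n) → ℝ) (x : EuclideanSpace ℝ (Fin n)) : Fin m → ℝ :=
  fun i => (f i x + g i x - (h i x : EReal)).toReal

/-- `x₀ ∈ S` is a local weak Pareto solution of minimizing `F` over `S`: on some neighborhood
`U` of `x₀` there is no `x ∈ S ∩ U` with `F x ∈ F x₀ - int ℝ^m_+`. -/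
def IsLocalWeakParetoSolution (S : Set (EuclideanSpace ℝ (Fin n)))
    (F : EuclideanSpace ℝ (Fin n) → Fin m → ℝ) (x₀ : EuclideanSpace ℝ (Fin n)) : Prop :=
  x₀ ∈ S ∧ ∃ U ∈ 𝓝 x₀,
    ¬ ∃ x ∈ S ∩ U, F x ∈ {F x₀} - interior {y : Fin m → ℝ | ∀ i, 0 ≤ y i}

/-- `x₀ ∈ S` is a stationary point of minimizing `f + g - h` over `S`. Sums, differences
and multiples of sets are those of Minkowski. -/
def IsStationaryPoint (S : Set (EuclideanSpace ℝ (Fin n)))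
    (f g : Fin m → EuclideanSpace ℝ (Fin n) → EReal)
    (h : Fin m → EuclideanSpace ℝ (Fin n) → ℝ) (x₀ : EuclideanSpace ℝ (Fin n)) : Prop :=
  x₀ ∈ S ∧ ∃ c : Fin m → ℝ, (∀ i, 0 ≤ c i) ∧ c ≠ 0 ∧
    (0 : EuclideanSpace ℝ (Fin n)) ∈
      (∑ i, c i • (limitingSubdifferential (f i) x₀ + {gradient (fun x => (g i x).toReal) x₀}
          - limitingSubdifferential (fun x => (h i x : EReal)) x₀))
        + limitingNormalCone S x₀

end Problem

end MOP

end

open Filter Topology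
open scoped Pointwise

/-! Weak convexity puts a paraboloid under each `h i`: for some `p i`, `h i x ≥ h i x₀ + ⟪p i, x -
x₀⟫ - β / 2 * ‖x - x₀‖ ^ 2` near `x₀` (`WeaklyConvexOn.exists_proximal_subgradient`). The resulting
upper bound for `-h i` is exact at `x₀`, so `x₀` stays locally weakly optimal when it replaces `-h
i`. The objectives become `φ i = f i + s i` with `s i` continuously differentiable near `x₀` and
gradient `∇(g i)(x₀) - p i` there.

The multiplier rule for the Lipschitz `φ i` is variational. Each `φ i` gets its own copy `x i` of
the variable, tied to a point `z ∈ S` by the penalty `k / 2 * ‖x i - z‖ ^ 2`, and the maximum of the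
increments is smoothed by log-sum-exp. For large `k` a minimizer is near `x₀`
(`decoupled_localization`). Minimality in `x i` gives a regular subgradient `v i` with `c i • v i =
-k • (x i - z)`, where `c` are the softmax weights; minimality in `z` makes `-∑ c i • v i`, up to a
vanishing term, a regular normal to `S` (`exists_approximate_multipliers`). Compactness yields
limits (`exists_limiting_multipliers`), and subtracting `∇(s i)` before the limit leaves
subgradients of `f i`. -/

namespace MOP

/-! ### Regular subgradients and their limits -/

section Subgradients

variable {X : Type*} [NormedAddCommGroup X] [InnerProductSpace ℝ X]

/-- `v` is a regular (Fréchet) subgradient of the real-valued function `φ` at `x`. -/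
def IsRegularSubgradient (φ : X → ℝ) (x v : X) : Prop :=
  ∀ ε : ℝ, 0 < ε → ∀ᶠ y in 𝓝 x, inner ℝ v (y - x) - ε * ‖y - x‖ ≤ φ y - φ x

theorem IsRegularSubgradient.sub_hasGradientAt [CompleteSpace X] {φ s : X → ℝ} {x v a : X}
    (hv : IsRegularSubgradient (fun y => φ y + s y) x v) (hs : HasGradientAt s a x) :
    IsRegularSubgradient φ x (v - a) := by
  intro ε hε
  have h1 := (hasGradientAt_iff_isLittleO.1 hs).def (half_pos hε)
  filter_upwards [h1, hv (ε / 2) (half_pos hε)] with y hy1 hy2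
  rw [Real.norm_eq_abs] at hy1
  have := (abs_le.1 hy1).2
  rw [inner_sub_left]
  linarith

/-- A regular subgradient of a function with Lipschitz constant `L` has norm at most `L`. -/
theorem IsRegularSubgradient.norm_le {φ : X → ℝ} {x v : X} {L : ℝ}
    (hv : IsRegularSubgradient φ x v) (hL : 0 ≤ L)
    (hφ : ∀ᶠ y in 𝓝 x, φ y - φ x ≤ L * ‖y - x‖) : ‖v‖ ≤ L := by
  refine le_of_forall_pos_le_add fun ε hε => ?_
  rcases eq_or_ne v 0 with rfl | hv0
  · simp only [norm_zero]; positivity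
  have hvpos : 0 < ‖v‖ := norm_pos_iff.2 hv0
  have hlim : Tendsto (fun t : ℝ => x + t • v) (𝓝[>] 0) (𝓝 x) := by
    have : Tendsto (fun t : ℝ => x + t • v) (𝓝 0) (𝓝 (x + (0 : ℝ) • v)) :=
      Continuous.tendsto (by fun_prop) 0
    simpa using this.mono_left nhdsWithin_le_nhds
  obtain ⟨t, ⟨ht1, ht2⟩, ht⟩ :=
    (((hlim.eventually (hv ε hε)).and (hlim.eventually hφ)).and self_mem_nhdsWithin).exists
  have ht : 0 < t := ht
  simp only [add_sub_cancel_left, norm_smul, Real.norm_eq_abs, abs_of_pos ht, inner_smul_right,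
    real_inner_self_eq_norm_sq] at ht1 ht2
  have h3 : (t * ‖v‖) * ‖v‖ ≤ (t * ‖v‖) * (L + ε) := by nlinarith
  exact le_of_mul_le_mul_left h3 (by positivity)

/-- On the epigraph the height increment dominates that of `φ`, so the component `-1` absorbs it.
Finiteness from below is needed because `toReal` sends `⊥` to `0`. -/
theorem IsRegularSubgradient.mem_regularNormalCone {φ : X → EReal} {x v : X} {r : ℝ}
    (hv : IsRegularSubgradient (fun y => (φ y).toReal) x v) (hr : φ x = r)
    (hφ : ∀ᶠ y in 𝓝 x, φ y ≠ ⊥) :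
    WithLp.toLp 2 (v, (-1 : ℝ)) ∈ regularNormalCone (epigraph φ) (WithLp.toLp 2 (x, r)) := by
  refine ⟨by simp [epigraph, hr], fun ε hε => ?_⟩
  have hlim : Tendsto (fun p : WithLp 2 (X × ℝ) => p.fst)
      (𝓝[epigraph φ] (WithLp.toLp 2 (x, r))) (𝓝 x) := by
    have : Continuous (fun p : WithLp 2 (X × ℝ) => p.fst) := by fun_prop
    exact (this.tendsto (WithLp.toLp 2 (x, r))).mono_left nhdsWithin_le_nhds
  filter_upwards [hlim.eventually (hv ε hε), hlim.eventually hφ, self_mem_nhdsWithin]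
    with p hp hbot hpe
  have hpe : φ p.fst ≤ (p.snd : EReal) := hpe
  have h1 : (φ p.fst).toReal ≤ p.snd := by
    have := EReal.toReal_le_toReal hpe hbot (EReal.coe_ne_top _)
    simpa using this
  have h2 : ‖p.fst - x‖ ≤ ‖p - WithLp.toLp 2 (x, r)‖ :=
    WithLp.norm_fst_le _ (p - WithLp.toLp 2 (x, r))
  have h3 := mul_le_mul_of_nonneg_left h2 hε.le
  simp only [hr, EReal.toReal_coe] at hp
  rw [WithLp.prod_inner_apply]
  simp
  linarith

/-- The limits of regular subgradients of a continuous function are limiting subgradients. -/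
theorem mem_limitingSubdifferential_of_tendsto {φ : X → EReal} {x v : X} {U : Set X}
    (hU : IsOpen U) (hx : x ∈ U) (hfin : ∀ y ∈ U, φ y ≠ ⊤ ∧ φ y ≠ ⊥)
    (hc : ContinuousAt (fun y => (φ y).toReal) x) {y w : ℕ → X} (hyU : ∀ k, y k ∈ U)
    (hy : Tendsto y atTop (𝓝 x)) (hw : Tendsto w atTop (𝓝 v))
    (hreg : ∀ k, IsRegularSubgradient (fun y => (φ y).toReal) (y k) (w k)) :
    v ∈ limitingSubdifferential φ x := by
  have hco : ∀ y ∈ U, φ y = ((φ y).toReal : EReal) := fun y hy =>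
    (EReal.coe_toReal (hfin y hy).1 (hfin y hy).2).symm
  have hlp : Continuous (WithLp.toLp 2 : X × ℝ → WithLp 2 (X × ℝ)) :=
    WithLp.prod_continuous_toLp 2 X ℝ
  refine ⟨(φ x).toReal, hco x hx, ?_, fun k => WithLp.toLp 2 (y k, (φ (y k)).toReal),
    fun k => WithLp.toLp 2 (w k, -1), fun k => ?_, ?_, ?_, fun k => ?_⟩
  · simp [epigraph, ← hco x hx]
  · simp [epigraph, ← hco _ (hyU k)]
  · exact (hlp.tendsto _).comp (hy.prodMk_nhds (hc.tendsto.comp hy))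
  · exact (hlp.tendsto _).comp (hw.prodMk_nhds tendsto_const_nhds)
  · refine (hreg k).mem_regularNormalCone (hco _ (hyU k)) ?_
    filter_upwards [hU.mem_nhds (hyU k)] with z hz using (hfin z hz).2

theorem isRegularSubgradient_of_proximal {φ : X → ℝ} {x v : X} {c : ℝ}
    (hv : ∀ᶠ y in 𝓝 x, φ x + inner ℝ v (y - x) - c * ‖y - x‖ ^ 2 ≤ φ y) :
    IsRegularSubgradient φ x v := by
  intro ε hε
  have h1 : ∀ᶠ y in 𝓝 x, c * ‖y - x‖ < ε := by
    have : Continuous fun y : X => c * ‖y - x‖ := by fun_prop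
    exact this.continuousAt.eventually_lt continuousAt_const (by simpa using hε)
  filter_upwards [hv, h1] with y hy1 hy2
  have := mul_le_mul_of_nonneg_right hy2.le (norm_nonneg (y - x))
  nlinarith

theorem IsRegularSubgradient.mem_limitingSubdifferential_coe {φ : X → ℝ} {x v : X}
    (hv : IsRegularSubgradient φ x v) :
    v ∈ limitingSubdifferential (fun y => (φ y : EReal)) x := by
  have h1 := IsRegularSubgradient.mem_regularNormalCone (φ := fun y => (φ y : EReal)) hv rfl
    (Eventually.of_forall fun y => EReal.coe_ne_bot _)
  exact ⟨φ x, rfl, h1.1, fun _ => _, fun _ => _, fun _ => h1.1, tendsto_const_nhds,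
    tendsto_const_nhds, fun _ => h1⟩

end Subgradients

/-! ### Subgradients of convex and weakly convex functions -/

section Convex

variable {X : Type*} [NormedAddCommGroup X] [InnerProductSpace ℝ X] [FiniteDimensional ℝ X]

theorem _root_.ConvexOn.exists_subgradient {B : Set X} {φ : X → ℝ} (hφ : ConvexOn ℝ B φ)
    (hB : IsOpen B) {x : X} (hx : x ∈ B) :
    ∃ p : X, ∀ y ∈ B, φ x + inner ℝ p (y - x) ≤ φ y := by
  have hopen : IsOpen {p : X × ℝ | p.1 ∈ B ∧ φ p.1 < p.2} := by
    have h1 : ContinuousOn (fun p : X × ℝ => p.2 - φ p.1) (B ×ˢ Set.univ) :=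
      continuousOn_snd.sub ((hφ.continuousOn hB).comp continuousOn_fst fun p hp => hp.1)
    have h2 := h1.isOpen_inter_preimage (hB.prod isOpen_univ) isOpen_Ioi (t := Set.Ioi 0)
    convert h2 using 1
    ext p
    simp
  obtain ⟨l, hl⟩ := geometric_hahn_banach_open_point hφ.convex_strict_epigraph hopen
    (x := (x, φ x)) (by simp)
  have hsplit : ∀ (y : X) (t : ℝ), l (y, t) = l (y, 0) + t * l (0, 1) := by
    intro y t
    have : ((y, t) : X × ℝ) = (y, 0) + t • ((0, 1) : X × ℝ) := by simp
    rw [this, map_add, map_smul, smul_eq_mul]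
  -- The separating hyperplane is not vertical, since the strict epigraph contains a point right
  -- above `(x, φ x)`.
  have hc : l (0, 1) < 0 := by
    have := hl (x, φ x + 1) ⟨hx, by simp⟩
    rw [hsplit x (φ x + 1), hsplit x (φ x)] at this
    linarith
  set c := l (0, 1) with hcdef
  let ℓ : X →L[ℝ] ℝ := l.comp (ContinuousLinearMap.inl ℝ X ℝ)
  have hℓ : ∀ y, l (y, 0) = ℓ y := fun y => rfl
  refine ⟨(-c)⁻¹ • (InnerProductSpace.toDual ℝ X).symm ℓ, fun y hy => ?_⟩
  rw [real_inner_smul_left, InnerProductSpace.toDual_symm_apply, map_sub]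
  have key : ℓ y + φ y * c ≤ ℓ x + φ x * c := by
    refine le_of_forall_pos_le_add fun ε hε => ?_
    have hd : 0 < ε / (-c) := div_pos hε (by linarith)
    have := hl (y, φ y + ε / (-c)) ⟨hy, by simpa using hd⟩
    rw [hsplit y, hsplit x, hℓ, hℓ, add_mul] at this
    have h2 : ε / (-c) * c = -ε := by rw [div_neg, neg_mul, div_mul_cancel₀ _ hc.ne]
    linarith
  have h1 : (-c)⁻¹ * (ℓ y - ℓ x) ≤ φ y - φ x := by
    rw [inv_mul_le_iff₀ (by linarith)]
    linarith
  linarith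

/-- A weakly convex function has a proximal subgradient at each point of its open domain. -/
theorem WeaklyConvexOn.exists_proximal_subgradient {β : ℝ} {h : X → ℝ} {U : Set X}
    (hh : WeaklyConvexOn β h U) (hU : IsOpen U) {x : X} (hx : x ∈ U) :
    ∃ p : X, ∀ᶠ y in 𝓝 x, h x + inner ℝ p (y - x) - β / 2 * ‖y - x‖ ^ 2 ≤ h y := by
  obtain ⟨r, hr, hball⟩ := Metric.isOpen_iff.1 hU x hx
  obtain ⟨p, hp⟩ := (hh _ hball (convex_ball x r)).exists_subgradient Metric.isOpen_ball
    (Metric.mem_ball_self hr)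
  -- `β • x` is the gradient at `x` of the added quadratic.
  refine ⟨p - β • x, ?_⟩
  filter_upwards [Metric.ball_mem_nhds x hr] with y hy
  have h1 := hp y hy
  have h2 : ‖y‖ ^ 2 = ‖x‖ ^ 2 + 2 * inner ℝ x (y - x) + ‖y - x‖ ^ 2 := by
    rw [← norm_add_sq_real, add_sub_cancel]
  rw [inner_sub_left, real_inner_smul_left]
  simp only [h2] at h1
  linarith

end Convex

/-! ### Smoothing the maximum -/

section LogSumExp

variable {ι : Type*} [Fintype ι] [Nonempty ι]

/-- The smooth approximation `k⁻¹ log ∑ exp (k uᵢ)` of the maximum of the `uᵢ`. -/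
noncomputable def logSumExp (k : ℝ) (u : ι → ℝ) : ℝ :=
  k⁻¹ * Real.log (∑ i, Real.exp (k * u i))

theorem sum_exp_pos (k : ℝ) (u : ι → ℝ) : 0 < ∑ i, Real.exp (k * u i) :=
  Finset.sum_pos (fun _ _ => Real.exp_pos _) Finset.univ_nonempty

theorem le_logSumExp {k : ℝ} (hk : 0 < k) (u : ι → ℝ) (i : ι) : u i ≤ logSumExp k u := by
  rw [logSumExp, le_inv_mul_iff₀ hk, Real.le_log_iff_exp_le (sum_exp_pos k u)]
  exact Finset.single_le_sum (f := fun i => Real.exp (k * u i))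
    (fun _ _ => (Real.exp_pos _).le) (Finset.mem_univ i)

theorem continuous_logSumExp (k : ℝ) : Continuous (logSumExp k : (ι → ℝ) → ℝ) := by
  refine continuous_const.mul (Continuous.log (by fun_prop) fun u => (sum_exp_pos k u).ne')

/-- These partial derivatives are positive and sum to one; they become the multipliers. -/
theorem hasDerivAt_logSumExp_update [DecidableEq ι] {k : ℝ} (hk : 0 < k) (u : ι → ℝ) (i : ι) :
    HasDerivAt (fun t => logSumExp k (Function.update u i t))
      (Real.exp (k * u i) / ∑ j, Real.exp (k * u j)) (u i) := by
  have h1 : HasDerivAt (fun t => ∑ j, Real.exp (k * Function.update u i t j))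
      (∑ j, if j = i then k * Real.exp (k * u i) else 0) (u i) := by
    refine HasDerivAt.fun_sum fun j _ => ?_
    by_cases hj : j = i
    · subst hj
      have := ((hasDerivAt_id (u j)).const_mul k).exp
      simpa [mul_comm] using this
    · simpa [hj] using hasDerivAt_const (u i) (Real.exp (k * u j))
  have h2 := (h1.log (by simpa using (sum_exp_pos k u).ne')).const_mul k⁻¹
  refine h2.congr_deriv ?_
  rw [Function.update_eq_self, Finset.sum_ite_eq' Finset.univ i, if_pos (Finset.mem_univ i)]
  field_simp

end LogSumExp

/-! ### The decoupled penalized problem -/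

section Decoupled

variable {E : Type*} [NormedAddCommGroup E] {ι : Type*} [Fintype ι] [Nonempty ι]

/-- The objective of the decoupled, smoothed problem. -/
noncomputable def decoupled (φ : ι → E → ℝ) (x₀ : E) (k : ℝ) (x : ι → E) (z : E) : ℝ :=
  logSumExp k (fun i => φ i (x i) - φ i x₀) + k / 2 * ∑ i, ‖x i - z‖ ^ 2 + ‖z - x₀‖ ^ 2

theorem exists_penalty_parameter (C : ℝ) {ρ : ℝ} (hC : 0 ≤ C) (hρ : 0 < ρ) :
    ∃ k : ℝ, 1 ≤ k ∧ C / k < (ρ / 4) ^ 2 := by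
  refine ⟨C / (ρ / 4) ^ 2 + 1, ?_, ?_⟩
  · have : 0 ≤ C / (ρ / 4) ^ 2 := by positivity
    linarith
  · rw [div_lt_iff₀ (by positivity)]
    have : (ρ / 4) ^ 2 * (C / (ρ / 4) ^ 2 + 1) = C + (ρ / 4) ^ 2 := by field_simp
    rw [this]
    have : 0 < (ρ / 4) ^ 2 := by positivity
    linarith

/-- A point where the decoupled objective does not exceed its value at the reference point is
close to the reference point. -/
theorem decoupled_localization {φ : ι → E → ℝ} {x₀ z : E} {x : ι → E} {k L ρ : ℝ} (hk : 1 ≤ k)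
    (hρ : 0 < ρ) (hkρ : (Real.log (Fintype.card ι) + L ^ 2) / k < (ρ / 4) ^ 2)
    {i : ι} (hi : -(L * ‖x i - z‖) ≤ φ i (x i) - φ i x₀)
    (hle : decoupled φ x₀ k x z ≤ decoupled φ x₀ k (fun _ => x₀) x₀) :
    ‖z - x₀‖ < ρ ∧ ∀ j, ‖x j - x₀‖ < ρ := by
  have hk0 : 0 < k := by linarith
  have h0 : decoupled φ x₀ k (fun _ => x₀) x₀ = Real.log (Fintype.card ι) / k := by
    simp [decoupled, logSumExp]
    ring
  have h1 := hi.trans (le_logSumExp hk0 (fun i => φ i (x i) - φ i x₀) i)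
  have hsum : ∀ j, ‖x j - z‖ ^ 2 ≤ ∑ i, ‖x i - z‖ ^ 2 := fun j =>
    Finset.single_le_sum (f := fun i => ‖x i - z‖ ^ 2) (fun _ _ => by positivity)
      (Finset.mem_univ j)
  rw [h0, decoupled] at hle
  set T := ∑ i, ‖x i - z‖ ^ 2
  -- Young's inequality: half of the penalty absorbs the Lipschitz loss, at a cost of `L ^ 2 / k`.
  have h2 : L * ‖x i - z‖ ≤ k / 4 * ‖x i - z‖ ^ 2 + L ^ 2 / k := by
    have : k / 4 * ‖x i - z‖ ^ 2 + L ^ 2 / k - L * ‖x i - z‖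
        = (k / 2 * ‖x i - z‖ - L) ^ 2 / k := by field_simp; ring
    have h3 : 0 ≤ (k / 2 * ‖x i - z‖ - L) ^ 2 / k := by positivity
    linarith
  have h3 : k / 4 * T + ‖z - x₀‖ ^ 2 < (ρ / 4) ^ 2 := by
    rw [add_div] at hkρ
    have := mul_le_mul_of_nonneg_left (hsum i) (by positivity : 0 ≤ k / 4)
    linarith
  have hz : ‖z - x₀‖ < ρ / 4 := by
    refine lt_of_pow_lt_pow_left₀ 2 (by positivity) ?_
    have : 0 ≤ k / 4 * T := by positivity
    linarith
  refine ⟨by linarith, fun j => ?_⟩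
  have hxz : ‖x j - z‖ < ρ / 2 := by
    refine lt_of_pow_lt_pow_left₀ 2 (by positivity) ?_
    have h4 := hsum j
    have h5 : 0 ≤ ‖z - x₀‖ ^ 2 := by positivity
    have h6 : 0 ≤ T := (sq_nonneg _).trans h4
    nlinarith
  calc ‖x j - x₀‖ ≤ ‖x j - z‖ + ‖z - x₀‖ := norm_sub_le_norm_sub_add_norm_sub _ _ _
    _ < ρ := by linarith

end Decoupled

/-! ### Approximate multipliers from the decoupled minimizer -/

section Fuzzy

variable {E : Type*} [NormedAddCommGroup E] [InnerProductSpace ℝ E]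

/-- The first-order condition for `x` minimizing `θ ∘ φ + k / 2 * ‖· - z‖ ^ 2` locally. -/
theorem isRegularSubgradient_of_isLocalMin {φ : E → ℝ} {θ : ℝ → ℝ} {x z : E} {k L c : ℝ}
    (hc : 0 < c) (hL : 0 ≤ L) (hθ : HasDerivAt θ c (φ x))
    (hφ : ∀ᶠ y in 𝓝 x, |φ y - φ x| ≤ L * ‖y - x‖)
    (hmin : IsLocalMin (fun y => θ (φ y) + k / 2 * ‖y - z‖ ^ 2) x) :
    IsRegularSubgradient φ x (-(k / c) • (x - z)) := by
  intro ε hε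
  have hlim : Tendsto φ (𝓝 x) (𝓝 (φ x)) := by
    rw [tendsto_iff_norm_sub_tendsto_zero]
    refine squeeze_zero' (Eventually.of_forall fun _ => norm_nonneg _) hφ ?_
    have : Continuous fun y => L * ‖y - x‖ := by fun_prop
    simpa using this.tendsto x
  -- The remainder of `θ` then costs half of `c * ε * ‖y - x‖` and the quadratic term the other
  -- half; `L + 1` avoids dividing by zero.
  have hη : 0 < c * ε / (2 * (L + 1)) := by positivity
  have h1 := hlim.eventually ((hasDerivAt_iff_isLittleO.1 hθ).def hη)
  have h2 : ∀ᶠ y in 𝓝 x, k / 2 * ‖y - x‖ < c * ε / 2 := by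
    have : Continuous fun y : E => k / 2 * ‖y - x‖ := by fun_prop
    exact this.continuousAt.eventually_lt continuousAt_const (by simp; positivity)
  filter_upwards [h1, h2, hφ, hmin] with y hy1 hy2 hy3 hy4
  have hn := norm_nonneg (y - x)
  rw [Real.norm_eq_abs, Real.norm_eq_abs, smul_eq_mul] at hy1
  have h3 := (abs_le.1 hy1).2
  have h4 : c * ε / (2 * (L + 1)) * |φ y - φ x| ≤ c * ε / 2 * ‖y - x‖ := by
    calc _ ≤ c * ε / (2 * (L + 1)) * ((L + 1) * ‖y - x‖) := by
          refine mul_le_mul_of_nonneg_left (hy3.trans ?_) hη.le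
          nlinarith
      _ = _ := by field_simp
  have h5 : ‖y - z‖ ^ 2 = ‖x - z‖ ^ 2 + 2 * inner ℝ (x - z) (y - x) + ‖y - x‖ ^ 2 := by
    rw [← norm_add_sq_real]; congr 2; abel
  have h6 := mul_le_mul_of_nonneg_right hy2.le hn
  rw [h5] at hy4
  rw [real_inner_smul_left]
  have h7 : -(k * inner ℝ (x - z) (y - x)) - c * ε * ‖y - x‖ ≤ (φ y - φ x) * c := by
    nlinarith
  have h8 : -(k / c) * inner ℝ (x - z) (y - x) - ε * ‖y - x‖
      = (-(k * inner ℝ (x - z) (y - x)) - c * ε * ‖y - x‖) / c := by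
    field_simp
  rw [h8, div_le_iff₀ hc]
  exact h7

theorem mem_regularNormalCone_of_proximal {S : Set E} {z w : E} {M : ℝ} (hz : z ∈ S)
    (hw : ∀ᶠ y in 𝓝[S] z, inner ℝ w (y - z) ≤ M * ‖y - z‖ ^ 2) :
    w ∈ regularNormalCone S z := by
  refine ⟨hz, fun ε hε => ?_⟩
  have h1 : ∀ᶠ y in 𝓝[S] z, M * ‖y - z‖ < ε := by
    have : Continuous fun y : E => M * ‖y - z‖ := by fun_prop
    exact (this.continuousAt.eventually_lt continuousAt_const (by simpa using hε)).filter_mono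
      nhdsWithin_le_nhds
  filter_upwards [hw, h1] with y hy1 hy2
  have := mul_le_mul_of_nonneg_right hy2.le (norm_nonneg (y - z))
  nlinarith

variable {ι : Type*} [Fintype ι] [Nonempty ι]

/-- Approximate multiplier rule: if no point of `S` near `x₀` strictly decreases all `φ i`, then
near `x₀` there are regular subgradients of the `φ i` a convex combination of which is almost
opposite to a regular normal of `S`. -/
theorem exists_approximate_multipliers [FiniteDimensional ℝ E] {S : Set E} (hS : IsClosed S)
    {x₀ : E} (hx₀ : x₀ ∈ S) {r L δ : ℝ} (hr : 0 < r) (hL : 0 ≤ L) (hδ : 0 < δ) {φ : ι → E → ℝ}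
    (hlip : ∀ i, ∀ x ∈ Metric.closedBall x₀ r, ∀ y ∈ Metric.closedBall x₀ r,
      |φ i x - φ i y| ≤ L * ‖x - y‖)
    (hmin : ∀ z ∈ S ∩ Metric.closedBall x₀ r, ∃ i, φ i x₀ ≤ φ i z) :
    ∃ (x : ι → E) (z : E) (c : ι → ℝ) (v : ι → E), (∀ i, ‖x i - x₀‖ < δ) ∧ ‖z - x₀‖ < δ ∧
      (∀ i, 0 ≤ c i) ∧ ∑ i, c i = 1 ∧ (∀ i, IsRegularSubgradient (φ i) (x i) (v i)) ∧
      -(∑ i, c i • v i) - (2 : ℝ) • (z - x₀) ∈ regularNormalCone S z := by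
  classical
  have hρ : 0 < min δ r := lt_min hδ hr
  -- The value at the reference point is `log (card ι) / k`; `L ^ 2 / k` is the Young loss.
  obtain ⟨k, hk, hkρ⟩ := exists_penalty_parameter (Real.log (Fintype.card ι) + L ^ 2)
    (by have := Real.log_natCast_nonneg (Fintype.card ι); positivity) hρ
  have hk0 : 0 < k := by linarith
  let B := Metric.closedBall x₀ r
  have hx₀B : x₀ ∈ B := Metric.mem_closedBall_self hr.le
  let K : Set ((ι → E) × E) := (Set.univ.pi fun _ => B) ×ˢ (S ∩ B)
  have hK : IsCompact K :=
    (isCompact_univ_pi fun _ => isCompact_closedBall x₀ r).prod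
      ((isCompact_closedBall x₀ r).inter_left hS)
  have hφc : ∀ i, ContinuousOn (φ i) B := fun i =>
    (LipschitzOnWith.of_dist_le_mul (K := ⟨L, hL⟩) fun x hx y hy => by
      rw [Real.dist_eq, dist_eq_norm]
      exact hlip i x hx y hy).continuousOn
  have hcont : ContinuousOn (fun p : (ι → E) × E => decoupled φ x₀ k p.1 p.2) K := by
    have h1 : ContinuousOn (fun p : (ι → E) × E => fun i => φ i (p.1 i) - φ i x₀) K := by
      refine continuousOn_pi.2 fun i => ContinuousOn.sub ?_ continuousOn_const
      exact (hφc i).comp (by fun_prop) fun p hp => hp.1 i trivial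
    exact ((((continuous_logSumExp k).comp_continuousOn h1).add (by fun_prop)).add (by fun_prop))
  obtain ⟨⟨x, z⟩, ⟨hxB, hzS, hzB⟩, hopt⟩ :=
    hK.exists_isMinOn ⟨(fun _ => x₀, x₀), fun _ _ => hx₀B, hx₀, hx₀B⟩ hcont
  have hxB : ∀ i, x i ∈ B := fun i => hxB i trivial
  have hopt : ∀ (x' : ι → E) (z' : E), (∀ i, x' i ∈ B) → z' ∈ S → z' ∈ B →
      decoupled φ x₀ k x z ≤ decoupled φ x₀ k x' z' := fun x' z' h1 h2 h3 =>
    hopt (a := (x', z')) ⟨fun i _ => h1 i, h2, h3⟩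
  -- Weak optimality at `z` together with the Lipschitz bound keeps the increment of `φ i₀` at `x
  -- i₀` above `-L * ‖x i₀ - z‖`.
  obtain ⟨i₀, hi₀⟩ := hmin z ⟨hzS, hzB⟩
  obtain ⟨hz, hx⟩ := decoupled_localization (i := i₀) hk hρ hkρ
    (by have := (abs_le.1 (hlip i₀ _ (hxB i₀) z hzB)).1; linarith)
    (hopt _ _ (fun _ => hx₀B) hx₀ hx₀B)
  have hnhds : ∀ y : E, ‖y - x₀‖ < min δ r → B ∈ 𝓝 y := fun y hy =>
    mem_of_superset (Metric.isOpen_ball.mem_nhds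
      (mem_ball_iff_norm.2 (hy.trans_le (min_le_right _ _)))) Metric.ball_subset_closedBall
  set u : ι → ℝ := fun i => φ i (x i) - φ i x₀ with hu
  let c : ι → ℝ := fun i => Real.exp (k * u i) / ∑ j, Real.exp (k * u j)
  have hc : ∀ i, 0 < c i := fun i => div_pos (Real.exp_pos _) (sum_exp_pos k u)
  refine ⟨x, z, c, fun i => -(k / c i) • (x i - z), fun i => (hx i).trans_le (min_le_left _ _),
    hz.trans_le (min_le_left _ _), fun i => (hc i).le, ?_, fun i => ?_, ?_⟩
  · rw [← Finset.sum_div, div_self (sum_exp_pos k u).ne']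
  · refine isRegularSubgradient_of_isLocalMin
      (θ := fun t => logSumExp k (Function.update u i (t - φ i x₀))) (hc i) hL ?_ ?_ ?_
    · have h1 : HasDerivAt (fun t => logSumExp k (Function.update u i t)) (c i)
          (φ i (x i) - φ i x₀) := hasDerivAt_logSumExp_update hk0 u i
      exact h1.comp_sub_const _ _
    · filter_upwards [hnhds _ (hx i)] with y hy using hlip i y hy _ (hxB i)
    · filter_upwards [hnhds _ (hx i)] with y hy
      have h1 := hopt (Function.update x i y) z (fun j => by
        by_cases hj : j = i
        · subst hj; simpa using hy
        · simpa [hj] using hxB j) hzS hzB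
      have h2 : (fun j => φ j (Function.update x i y j) - φ j x₀)
          = Function.update u i (φ i y - φ i x₀) := by
        ext j
        by_cases hj : j = i
        · subst hj; simp
        · simp [hj, hu]
      have h3 : ∑ j, ‖Function.update x i y j - z‖ ^ 2
          = ∑ j, ‖x j - z‖ ^ 2 - ‖x i - z‖ ^ 2 + ‖y - z‖ ^ 2 := by
        rw [← Finset.add_sum_erase _ _ (Finset.mem_univ i),
          ← Finset.add_sum_erase _ (fun j => ‖x j - z‖ ^ 2) (Finset.mem_univ i)]
        have : ∑ j ∈ Finset.univ.erase i, ‖Function.update x i y j - z‖ ^ 2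
            = ∑ j ∈ Finset.univ.erase i, ‖x j - z‖ ^ 2 :=
          Finset.sum_congr rfl fun j hj => by simp [Finset.ne_of_mem_erase hj]
        rw [this]
        simp
        ring
      rw [decoupled, decoupled, h2, h3] at h1
      have h4 : Function.update u i (φ i (x i) - φ i x₀) = u := Function.update_eq_self i u
      rw [h4]
      linarith
  · have hcv : ∀ i, c i • (-(k / c i) • (x i - z)) = -(k • (x i - z)) := fun i => by
      rw [smul_smul, mul_neg, mul_div_cancel₀ _ (hc i).ne', neg_smul]
    simp only [hcv, Finset.sum_neg_distrib, neg_neg]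
    refine mem_regularNormalCone_of_proximal (M := k / 2 * Fintype.card ι + 1) hzS ?_
    filter_upwards [self_mem_nhdsWithin, nhdsWithin_le_nhds (hnhds z hz)] with y hyS hyB
    have h1 := hopt x y hxB hyS hyB
    have hsq : ∀ a : E, ‖a - y‖ ^ 2
        = ‖a - z‖ ^ 2 - 2 * inner ℝ (a - z) (y - z) + ‖y - z‖ ^ 2 := fun a => by
      rw [← norm_sub_sq_real, sub_sub_sub_cancel_right]
    have hsq' : ‖y - x₀‖ ^ 2
        = ‖z - x₀‖ ^ 2 + 2 * inner ℝ (z - x₀) (y - z) + ‖y - z‖ ^ 2 := by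
      rw [← norm_add_sq_real]; congr 2; abel
    simp only [decoupled, hsq, hsq', Finset.sum_add_distrib, Finset.sum_sub_distrib,
      Finset.sum_const, ← Finset.mul_sum, nsmul_eq_mul, Finset.card_univ] at h1
    rw [inner_sub_left, sum_inner, real_inner_smul_left]
    simp only [real_inner_smul_left, ← Finset.mul_sum]
    nlinarith

end Fuzzy

/-! ### Passage to limiting multipliers -/

section Multipliers

variable {E : Type*} [NormedAddCommGroup E] [InnerProductSpace ℝ E] [FiniteDimensional ℝ E]
  {ι : Type*} [Fintype ι] [Nonempty ι]

/-- Multiplier rule in terms of limits of regular subgradients. -/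
theorem exists_limiting_multipliers {S : Set E} (hS : IsClosed S)
    {x₀ : E} (hx₀ : x₀ ∈ S) {r L : ℝ} (hr : 0 < r) (hL : 0 ≤ L) {φ : ι → E → ℝ}
    (hlip : ∀ i, ∀ x ∈ Metric.closedBall x₀ r, ∀ y ∈ Metric.closedBall x₀ r,
      |φ i x - φ i y| ≤ L * ‖x - y‖)
    (hmin : ∀ z ∈ S ∩ Metric.closedBall x₀ r, ∃ i, φ i x₀ ≤ φ i z) :
    ∃ (c : ι → ℝ) (v : ι → E) (x w : ℕ → ι → E), (∀ i, 0 ≤ c i) ∧ ∑ i, c i = 1 ∧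
      (∀ k i, x k i ∈ Metric.ball x₀ r) ∧ (∀ i, Tendsto (fun k => x k i) atTop (𝓝 x₀)) ∧
      (∀ i, Tendsto (fun k => w k i) atTop (𝓝 (v i))) ∧
      (∀ k i, IsRegularSubgradient (φ i) (x k i) (w k i)) ∧
      -(∑ i, c i • v i) ∈ limitingNormalCone S x₀ := by
  have hδ : ∀ k : ℕ, 0 < r / (k + 1) := fun k => by positivity
  have hδr : ∀ k : ℕ, r / (k + 1) ≤ r := fun k =>
    div_le_self hr.le (by have : (0 : ℝ) ≤ k := k.cast_nonneg; linarith)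
  have hδ0 : Tendsto (fun k : ℕ => r / (k + 1)) atTop (𝓝 0) := by
    have := tendsto_one_div_add_atTop_nhds_zero_nat (𝕜 := ℝ).const_mul r
    simpa [div_eq_mul_inv] using this
  choose x z c v hx hz hc hc1 hv hN using
    fun k : ℕ => exists_approximate_multipliers hS hx₀ hr hL (hδ k) hlip hmin
  have hxr : ∀ k i, x k i ∈ Metric.ball x₀ r := fun k i =>
    mem_ball_iff_norm.2 ((hx k i).trans_le (hδr k))
  have hvL : ∀ k i, ‖v k i‖ ≤ L := fun k i => (hv k i).norm_le hL (by
    filter_upwards [Metric.isOpen_ball.mem_nhds (hxr k i)] with y hy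
    exact (abs_le.1 (hlip i y (Metric.ball_subset_closedBall hy) _
      (Metric.ball_subset_closedBall (hxr k i)))).2)
  have hc1' : ∀ k i, ‖c k i‖ ≤ 1 := fun k i => by
    rw [Real.norm_of_nonneg (hc k i), ← hc1 k]
    exact Finset.single_le_sum (fun j _ => hc k j) (Finset.mem_univ i)
  have hcpt : IsCompact (Metric.closedBall (0 : ι → ℝ) 1 ×ˢ Metric.closedBall (0 : ι → E) L) :=
    (isCompact_closedBall _ _).prod (isCompact_closedBall _ _)
  obtain ⟨⟨c', v'⟩, -, ψ, hψ, hlim⟩ := hcpt.tendsto_subseq (x := fun k => (c k, v k)) fun k =>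
    ⟨mem_closedBall_zero_iff.2 ((pi_norm_le_iff_of_nonneg zero_le_one).2 (hc1' k)),
      mem_closedBall_zero_iff.2 ((pi_norm_le_iff_of_nonneg hL).2 (hvL k))⟩
  have hclim : ∀ i, Tendsto (fun k => c (ψ k) i) atTop (𝓝 (c' i)) :=
    tendsto_pi_nhds.1 ((continuous_fst.tendsto _).comp hlim)
  have hvlim : ∀ i, Tendsto (fun k => v (ψ k) i) atTop (𝓝 (v' i)) :=
    tendsto_pi_nhds.1 ((continuous_snd.tendsto _).comp hlim)
  have hzlim : Tendsto (fun k => z (ψ k)) atTop (𝓝 x₀) := by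
    rw [tendsto_iff_norm_sub_tendsto_zero]
    exact squeeze_zero (fun _ => norm_nonneg _) (fun k => (hz (ψ k)).le)
      (hδ0.comp hψ.tendsto_atTop)
  refine ⟨c', v', fun k => x (ψ k), fun k => v (ψ k), fun i => ?_, ?_, fun k => hxr (ψ k),
    fun i => ?_, hvlim, fun k => hv (ψ k), hx₀, fun k => z (ψ k), _,
    fun k => (hN (ψ k)).1, hzlim, ?_, fun k => hN (ψ k)⟩
  · exact ge_of_tendsto' (hclim i) fun k => hc (ψ k) i
  · refine tendsto_nhds_unique (tendsto_finsetSum _ fun i _ => hclim i) ?_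
    simp [hc1]
  · rw [tendsto_iff_norm_sub_tendsto_zero]
    exact squeeze_zero (fun _ => norm_nonneg _) (fun k => (hx (ψ k) i).le)
      (hδ0.comp hψ.tendsto_atTop)
  · have h1 : Tendsto (fun k => -(∑ i, c (ψ k) i • v (ψ k) i)) atTop
        (𝓝 (-(∑ i, c' i • v' i))) :=
      (tendsto_finsetSum _ fun i _ => (hclim i).smul (hvlim i)).neg
    have h2 : Tendsto (fun k => (2 : ℝ) • (z (ψ k) - x₀)) atTop (𝓝 0) := by
      simpa using (hzlim.sub_const x₀).const_smul (2 : ℝ)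
    simpa using h1.sub h2

omit [FiniteDimensional ℝ E] in
theorem _root_.ContDiffAt.continuousAt_gradient [CompleteSpace E] {s : E → ℝ} {x : E}
    (hs : ContDiffAt ℝ 1 s x) : ContinuousAt (gradient s) x :=
  (InnerProductSpace.toDual ℝ E).symm.continuous.continuousAt.comp
    (hs.fderiv_right (m := 0) (by simp)).continuousAt

/-- Multiplier rule for locally Lipschitz functions perturbed by continuously differentiable
ones. -/
theorem exists_multipliers_add_contDiffAt {S : Set E} (hS : IsClosed S)
    {x₀ : E} (hx₀ : x₀ ∈ S) {f : ι → E → EReal} {s : ι → E → ℝ} {U : ι → Set E}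
    (hU : ∀ i, IsOpen (U i)) (hSU : ∀ i, S ⊆ U i) (hf : ∀ i, LocallyLipschitzOnSet (f i) (U i))
    (hs : ∀ i, ContDiffAt ℝ 1 (s i) x₀)
    (hmin : ∀ᶠ z in 𝓝[S] x₀, ∃ i, (f i x₀).toReal + s i x₀ ≤ (f i z).toReal + s i z) :
    ∃ (c : ι → ℝ) (v : ι → E), (∀ i, 0 ≤ c i) ∧ ∑ i, c i = 1 ∧
      (∀ i, v i ∈ limitingSubdifferential (f i) x₀) ∧
      -(∑ i, c i • (v i + gradient (s i) x₀)) ∈ limitingNormalCone S x₀ := by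
  have hfloc : ∀ i, ∃ K, ∃ t ∈ 𝓝 x₀, LipschitzOnWith K (fun x => (f i x).toReal) t := fun i => by
    obtain ⟨K, t, ht, hK⟩ := (hf i).2 (hSU i hx₀)
    exact ⟨K, t, by rwa [(hU i).nhdsWithin_eq (hSU i hx₀)] at ht, hK⟩
  choose K t ht hK using hfloc
  choose K' t' ht' hK' using fun i => (hs i).exists_lipschitzOnWith
  have hV : ∀ᶠ x in 𝓝 x₀, ∀ i, x ∈ U i ∧ x ∈ t i ∧ x ∈ t' i ∧ DifferentiableAt ℝ (s i) x := by
    refine eventually_all.2 fun i => ?_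
    filter_upwards [(hU i).mem_nhds (hSU i hx₀), ht i, ht' i, (hs i).eventually (by simp)]
      with x h1 h2 h3 h4
    exact ⟨h1, h2, h3, h4.differentiableAt (by simp)⟩
  obtain ⟨r, hr, hball⟩ := Metric.nhds_basis_closedBall.mem_iff.1
    (inter_mem hV (mem_nhdsWithin_iff_eventually.1 hmin))
  have hin : ∀ x ∈ Metric.closedBall x₀ r, ∀ i, x ∈ U i ∧ x ∈ t i ∧ x ∈ t' i ∧
      DifferentiableAt ℝ (s i) x := fun x hx => (hball hx).1
  obtain ⟨c, v, x, w, hc, hc1, hxr, hx, hw, hreg, hN⟩ :=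
    exists_limiting_multipliers (r := r) (L := ((∑ i, (K i + K' i) : NNReal) : ℝ)) hS hx₀ hr
      (NNReal.coe_nonneg _) (φ := fun i x => (f i x).toReal + s i x)
      (fun i x hx y hy => by
        have h1 : LipschitzOnWith (K i + K' i) (fun x => (f i x).toReal + s i x) (t i ∩ t' i) :=
          ((hK i).mono Set.inter_subset_left).add ((hK' i).mono Set.inter_subset_right)
        have h2 := h1.weaken (Finset.single_le_sum (f := fun i => K i + K' i)
          (fun _ _ => zero_le) (Finset.mem_univ i))
        have h3 := h2.dist_le_mul x ⟨(hin x hx i).2.1, (hin x hx i).2.2.1⟩ y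
          ⟨(hin y hy i).2.1, (hin y hy i).2.2.1⟩
        rwa [Real.dist_eq, dist_eq_norm] at h3)
      (fun z hz => (hball hz.2).2 hz.1)
  have hgrad : ∀ i, Tendsto (fun k => gradient (s i) (x k i)) atTop (𝓝 (gradient (s i) x₀)) :=
    fun i => (hs i).continuousAt_gradient.tendsto.comp (hx i)
  have hxin := fun k i => hin _ (Metric.ball_subset_closedBall (hxr k i)) i
  refine ⟨c, fun i => v i - gradient (s i) x₀, hc, hc1, fun i => ?_, by simpa using hN⟩
  exact mem_limitingSubdifferential_of_tendsto (hU i) (hSU i hx₀) (hf i).1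
    ((hK i).continuousOn.continuousAt (ht i)) (fun k => (hxin k i).1) (hx i)
    ((hw i).sub (hgrad i))
    fun k => (hreg k i).sub_hasGradientAt (hxin k i).2.2.2.hasGradientAt

end Multipliers

/-! ### Weak Pareto points and the stationarity theorem -/

theorem IsLocalWeakParetoSolution.eventually_exists_le {n m : ℕ}
    {S : Set (EuclideanSpace ℝ (Fin n))} {F : EuclideanSpace ℝ (Fin n) → Fin m → ℝ}
    {x₀ : EuclideanSpace ℝ (Fin n)} (hx₀ : IsLocalWeakParetoSolution S F x₀) :
    ∀ᶠ x in 𝓝[S] x₀, ∃ i, F x₀ i ≤ F x i := by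
  obtain ⟨-, U, hU, hno⟩ := hx₀
  filter_upwards [self_mem_nhdsWithin, nhdsWithin_le_nhds hU] with x hxS hxU
  by_contra! hlt
  refine hno ⟨x, ⟨hxS, hxU⟩, F x₀, rfl, F x₀ - F x, ?_, sub_sub_cancel _ _⟩
  have hopen : IsOpen {y : Fin m → ℝ | ∀ i, 0 < y i} := by
    simp only [Set.ofPred_forall]
    exact isOpen_iInter_of_finite fun i => isOpen_lt continuous_const (continuous_apply i)
  exact interior_maximal (fun y hy i => (hy i).le) hopen fun i => sub_pos.2 (hlt i)

/-- Up to a constant this function is the smooth upper model of `g - h`; its quadratic term has zero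
gradient at `x₀`. -/
theorem hasGradientAt_tilted {E : Type*} [NormedAddCommGroup E] [InnerProductSpace ℝ E]
    [CompleteSpace E] {g : E → ℝ} {x₀ : E} (hg : DifferentiableAt ℝ g x₀) (p : E) (b : ℝ) :
    HasGradientAt (fun x => g x - inner ℝ p (x - x₀) + b * ‖x - x₀‖ ^ 2)
      (gradient g x₀ - p) x₀ := by
  have h1 := hg.hasGradientAt.hasFDerivAt
  have h2 : HasFDerivAt (fun x => inner ℝ p (x - x₀)) (InnerProductSpace.toDual ℝ E p) x₀ :=
    ((InnerProductSpace.toDual ℝ E p).hasFDerivAt (x := x₀ - x₀)).comp (f := fun x => x - x₀) x₀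
      ((hasFDerivAt_id x₀).sub_const x₀)
  have h3 : HasFDerivAt (fun x => b * ‖x - x₀‖ ^ 2) (0 : E →L[ℝ] ℝ) x₀ := by
    have := (((hasFDerivAt_id x₀).sub_const x₀).norm_sq).const_mul b
    simpa using this
  rw [hasGradientAt_iff_hasFDerivAt, map_sub]
  refine ((h1.sub h2).add h3).congr_fderiv ?_
  rw [add_zero]

end MOP

theorem mainTheorem1 (n m : ℕ) (S : Set (EuclideanSpace ℝ (Fin n))) (hS : IsClosed S)
    (f g : Fin m → EuclideanSpace ℝ (Fin n) → EReal)
    (h : Fin m → EuclideanSpace ℝ (Fin n) → ℝ) (β : ℝ)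
    (hf_bot : ∀ i x, f i x ≠ ⊥) (hg_bot : ∀ i x, g i x ≠ ⊥)
    (hf : ∀ i, ∃ U, IsOpen U ∧ S ⊆ U ∧ MOP.LocallyLipschitzOnSet (f i) U)
    (hg : ∀ i, ∃ U, IsOpen U ∧ S ⊆ U ∧ MOP.ContDiffOnSet (g i) U)
    (hh : ∀ i, ∃ U, IsOpen U ∧ S ⊆ U ∧ MOP.WeaklyConvexOn β (h i) U)
    (x₀ : EuclideanSpace ℝ (Fin n))
    (hx₀ : MOP.IsLocalWeakParetoSolution S (MOP.objective f g h) x₀) :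
    MOP.IsStationaryPoint S f g h x₀ := by
  have hx₀S : x₀ ∈ S := hx₀.1
  have hdec := hx₀.eventually_exists_le
  -- For `m = 0` the orthant is the whole space and `x₀` would dominate itself.
  have : Nonempty (Fin m) := (hdec.self_of_nhdsWithin hx₀S).nonempty
  choose U hU hSU hf using hf
  choose V hV hSV hg using hg
  choose W hW hSW hh using hh
  choose p hp using fun i => (hh i).exists_proximal_subgradient (hW i) (hSW i hx₀S)
  have hobj : ∀ x ∈ S, ∀ i,
      MOP.objective f g h x i = (f i x).toReal + (g i x).toReal - h i x := by
    intro x hx i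
    have hfx := (hf i).1 x (hSU i hx)
    have hgx := (hg i).1 x (hSV i hx)
    rw [MOP.objective, EReal.toReal_sub (EReal.add_ne_top hfx.1 hgx.1) (by simp [hfx, hgx])
      (EReal.coe_ne_top _) (EReal.coe_ne_bot _), EReal.toReal_add hfx.1 hfx.2 hgx.1 hgx.2,
      EReal.toReal_coe]
  have hgx₀ : ∀ i, ContDiffAt ℝ 1 (fun x => (g i x).toReal) x₀ := fun i =>
    (hg i).2.contDiffAt ((hV i).mem_nhds (hSV i hx₀S))
  have hgrad := fun i =>
    (MOP.hasGradientAt_tilted ((hgx₀ i).differentiableAt (by simp)) (p i) (β / 2)).gradient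
  obtain ⟨c, v, hc, hc1, hv, hN⟩ := MOP.exists_multipliers_add_contDiffAt hS hx₀S hU hSU hf
    (s := fun i x => (g i x).toReal - inner ℝ (p i) (x - x₀) + β / 2 * ‖x - x₀‖ ^ 2)
    (fun i => ((hgx₀ i).sub (contDiffAt_const.inner ℝ (contDiffAt_id.sub contDiffAt_const))).add
      (contDiffAt_const.mul ((contDiffAt_id.sub contDiffAt_const).norm_sq ℝ))) (by
      filter_upwards [hdec, self_mem_nhdsWithin,
        nhdsWithin_le_nhds (eventually_all.2 hp)] with x ⟨i, hi⟩ hxS hpx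
      refine ⟨i, ?_⟩
      rw [hobj x hxS, hobj x₀ hx₀S] at hi
      have := hpx i
      simp only [sub_self, inner_zero_right, norm_zero]
      linarith)
  simp only [hgrad] at hN
  refine ⟨hx₀S, c, hc, ?_, ?_⟩
  · rintro rfl
    simp at hc1
  · refine ⟨_, Set.finsetSum_mem_finsetSum _ _ (fun i => c i • (v i + gradient
      (fun x => (g i x).toReal) x₀ - p i)) fun i _ => Set.smul_mem_smul_set
        (Set.sub_mem_sub (Set.add_mem_add (hv i) rfl) ?_), _, hN, ?_⟩
    · exact (MOP.isRegularSubgradient_of_proximal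
        ((hp i).mono fun y hy => hy.trans' (le_of_eq (by ring)) :
          ∀ᶠ y in 𝓝 x₀, h i x₀ + inner ℝ (p i) (y - x₀) - β / 2 * ‖y - x₀‖ ^ 2 ≤ h i y)).mem_limitingSubdifferential_coe
    · simp [add_sub_assoc]
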